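/- Let $\mathcal A=\{a_1,\dots,a_n\}\subset\mathbb Z$ with $0<a_1<\dots<a_n$ and $\gcd(a_1,\dots,a_n)=1$. Let $$I_{\mathcal A}=\Big\langle u^\alpha-u^\beta \;\Big|\; \alpha,\beta\in\mathbb N^n,\ \sum_i\alpha_ia_i=\sum_i\beta_ia_i\Big\rangle\subset\mathbb C[u_1,\dots,u_n],$$ let $Y_{\mathcal A}=V(I_{\mathcal A})\subset\mathbb C^n$ be the associated toric curve, and assume that $Y_{\mathcal A}$ is singular. Let $\mathcal J\subset\mathbb C[u_1,\dots,u_n]/I_{\mathcal A}$ be the logarithmic Jacobian ideal, that is (in dimension one), the ideal generated by the $u_i$ with $\det(a_i)=a_i\neq0$. Then: 1. $\mathcal J=\langle u_1,\dots,u_n\rangle$. 2. The Nash modification of $Y_{\mathcal A}$ is isomorphic, as a variety over $Y_{\mathcal A}$, to the blowup of $Y_{\mathcal A}$ along $\mathcal J$. Here the Nash modification is the Zariski closure in $Y_{\mathcal A}\times\mathbb P^{n-1}$ of the graph of the Gauss map $x\mapsto T_xY_{\mathcal A}\in G(1,n)=\mathbb P^{n-1}$ on $Y_{\mathcal A}\setminus\mathrm{Sing}(Y_{\mathcal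 A})$, together with its projection to $Y_{\mathcal A}$. The blowup is the Zariski closure in $Y_{\mathcal A}\times\mathbb P^{m-1}$ of the graph of $x\mapsto[f_1(x):\dots:f_m(x)]$ on $Y_{\mathcal A}\setminus V(\mathcal J)$, for a finite system of generators $f_1,\dots,f_m$ of $\mathcal J$; the isomorphism exists for every such system. 3. The zero locus of $\mathcal J$ in $Y_{\mathcal A}$ is exactly the origin, and it is the singular locus: $\mathrm{Sing}(Y_{\mathcal A})=V(\mathcal J)=\{0\}$. -/

import Mathlib

open scoped LinearAlgebra.Projectivization

noncomputable section

namespace ToricNash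

/-! ### Affine varieties in `ℂⁿ` -/

/-- The Zariski tangent space of `X ⊆ ℂⁿ` at `x`: the vectors killed by the differentials at `x` of
all polynomials vanishing on `X`. -/
def tangentSpace {n : ℕ} (X : Set (Fin n → ℂ)) (x : Fin n → ℂ) : Submodule ℂ (Fin n → ℂ) where
  carrier := {v | ∀ F ∈ MvPolynomial.vanishingIdeal ℂ X,
    ∑ i, v i * MvPolynomial.eval x (MvPolynomial.pderiv i F) = 0}
  add_mem' {v w} hv hw F hF := by
    simp only [Pi.add_apply, add_mul, Finset.sum_add_distrib, hv F hF, hw F hF, add_zero]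
  zero_mem' F _ := by simp
  smul_mem' c v hv F hF := by
    simp only [Pi.smul_apply, smul_eq_mul, mul_assoc, ← Finset.mul_sum, hv F hF, mul_zero]

/-- The dimension of `X ⊆ ℂⁿ`: the Krull dimension of its ring of polynomial functions. -/
def dimension {n : ℕ} (X : Set (Fin n → ℂ)) : WithBot ℕ∞ :=
  ringKrullDim (MvPolynomial (Fin n) ℂ ⧸ MvPolynomial.vanishingIdeal ℂ X)

/-- The singular locus of an irreducible affine variety `X ⊆ ℂⁿ`. -/
def singularLocus {n : ℕ} (X : Set (Fin n → ℂ)) : Set (Fin n → ℂ) :=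
  {x | x ∈ X ∧ (Module.finrank ℂ (tangentSpace X x) : WithBot ℕ∞) ≠ dimension X}

/-- The value at a point `x` of `V(I)` of an element of `ℂ[u₁, …, uₙ] / I`. -/
def evalAt {n : ℕ} (I : Ideal (MvPolynomial (Fin n) ℂ)) (x : MvPolynomial.zeroLocus ℂ I) :
    (MvPolynomial (Fin n) ℂ ⧸ I) →ₐ[ℂ] ℂ :=
  Ideal.Quotient.liftₐ I (MvPolynomial.aeval x.1) (fun F hF => x.2 F hF)

/-- The zero locus in `V(I) ⊆ ℂⁿ` of an ideal `J` of `ℂ[u₁, …, uₙ] / I`. -/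
def idealLocus {n : ℕ} {I : Ideal (MvPolynomial (Fin n) ℂ)}
    (J : Ideal (MvPolynomial (Fin n) ℂ ⧸ I)) : Set (Fin n → ℂ) :=
  {x | ∃ hx : x ∈ MvPolynomial.zeroLocus ℂ I, ∀ f ∈ J, evalAt I ⟨x, hx⟩ f = 0}

/-! ### Varieties in `ℂⁿ × ℙᵐ⁻¹` -/

/-- The product `ℂⁿ × ℙᵐ⁻¹`; it carries the Zariski topology (below), not a product topology. -/
def AffProj (n m : ℕ) : Type := (Fin n → ℂ) × ℙ ℂ (Fin m → ℂ)

/-- The coordinate in `ℂⁿ`. -/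
def AffProj.aff {n m : ℕ} (z : AffProj n m) : Fin n → ℂ := z.1

/-- The coordinate in `ℙᵐ⁻¹`, a line in `ℂᵐ`. -/
def AffProj.proj {n m : ℕ} (z : AffProj n m) : ℙ ℂ (Fin m → ℂ) := z.2

/-- The value of `F ∈ ℂ[x₁, …, xₙ][T₁, …, Tₘ]` at a point `(x, [v])`, computed with a representative
`v` of the line. It is only used for `F` homogeneous in `T`: its vanishing, and the quotient of two
values of the same degree, do not depend on the representative. -/
def AffProj.value {n m : ℕ} (F : MvPolynomial (Fin m) (MvPolynomial (Fin n) ℂ))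
    (z : AffProj n m) : ℂ :=
  MvPolynomial.eval₂ (MvPolynomial.eval z.aff) z.proj.rep F

/-- The Zariski topology of `ℂⁿ × ℙᵐ⁻¹`, generated by the complements of the zero loci of the
polynomials in `(x, T)` that are homogeneous in `T`. -/
instance (n m : ℕ) : TopologicalSpace (AffProj n m) :=
  TopologicalSpace.generateFrom
    {U | ∃ (d : ℕ) (F : MvPolynomial (Fin m) (MvPolynomial (Fin n) ℂ)),
      F.IsHomogeneous d ∧ U = {z | AffProj.value F z ≠ 0}}

/-- `g` is a regular function on the open subset `V` of `Z ⊆ ℂⁿ × ℙᵐ⁻¹`: locally on `V` it is a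
quotient of two polynomials in `(x, T)` that are homogeneous in `T` of the same degree. -/
def IsRegularOn {n m : ℕ} {Z : Set (AffProj n m)} (V : Set Z) (g : Z → ℂ) : Prop :=
  ∀ z ∈ V, ∃ U : Set Z, IsOpen U ∧ z ∈ U ∧ U ⊆ V ∧
    ∃ (d : ℕ) (F G : MvPolynomial (Fin m) (MvPolynomial (Fin n) ℂ)),
      F.IsHomogeneous d ∧ G.IsHomogeneous d ∧
      ∀ w ∈ U, AffProj.value G w.1 ≠ 0 ∧ g w = AffProj.value F w.1 / AffProj.value G w.1

/-- `Z ⊆ ℂⁿ × ℙᵐ⁻¹` and `W ⊆ ℂⁿ × ℙᵏ⁻¹` are isomorphic as varieties over `ℂⁿ`: there is a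
homeomorphism for the Zariski topologies that, together with its inverse, pulls regular functions
back to regular functions, and that commutes with the projections to `ℂⁿ`. -/
def IsomorphicOver {n m k : ℕ} (Z : Set (AffProj n m)) (W : Set (AffProj n k)) : Prop :=
  ∃ e : Z ≃ₜ W, (∀ z : Z, (e z).1.aff = z.1.aff) ∧
    ∀ V : Set W, IsOpen V → ∀ g : W → ℂ,
      (IsRegularOn V g ↔ IsRegularOn (e ⁻¹' V) (g ∘ e))

/-! ### Nash modification and blowup -/

/-- The graph of the Gauss map of a curve `X ⊆ ℂⁿ`, which sends a nonsingular point to the tangent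
line there, a point of the Grassmannian `G(1, n) = ℙⁿ⁻¹` of lines in `ℂⁿ`. -/
def gaussGraph {n : ℕ} (X : Set (Fin n → ℂ)) : Set (AffProj n n) :=
  {z | z.aff ∈ X \ singularLocus X ∧ z.proj.submodule = tangentSpace X z.aff}

/-- The Nash modification of a curve `X ⊆ ℂⁿ`, with the projection `AffProj.aff` to `X`. -/
def nashModification {n : ℕ} (X : Set (Fin n → ℂ)) : Set (AffProj n n) :=
  closure (gaussGraph X)

/-- The blowup of the variety `V(I) ⊆ ℂⁿ` along the ideal of `ℂ[u₁, …, uₙ] / I` generated by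
`f₁, …, fₘ`: the Zariski closure of the graph of `x ↦ [f₁(x) : ⋯ : fₘ(x)]`, which is defined
away from the common zeros of the `fᵢ`. -/
def blowup {n m : ℕ} (I : Ideal (MvPolynomial (Fin n) ℂ))
    (f : Fin m → MvPolynomial (Fin n) ℂ ⧸ I) : Set (AffProj n m) :=
  closure {z | ∃ (hx : z.aff ∈ MvPolynomial.zeroLocus ℂ I)
    (hv : (fun i => evalAt I ⟨z.aff, hx⟩ (f i)) ≠ 0),
      z.proj = Projectivization.mk ℂ (fun i => evalAt I ⟨z.aff, hx⟩ (f i)) hv}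

/-! ### Toric varieties -/

/-- The toric ideal of `a₁, …, aₙ ∈ ℤᵈ`. -/
def toricIdeal {n d : ℕ} (a : Fin n → Fin d → ℤ) : Ideal (MvPolynomial (Fin n) ℂ) :=
  Ideal.span {F | ∃ α β : Fin n →₀ ℕ, ∑ i, α i • a i = ∑ i, β i • a i ∧
    F = MvPolynomial.monomial α 1 - MvPolynomial.monomial β 1}

/-- The affine toric variety of `a₁, …, aₙ ∈ ℤᵈ`. -/
def toricVariety {n d : ℕ} (a : Fin n → Fin d → ℤ) : Set (Fin n → ℂ) :=
  MvPolynomial.zeroLocus ℂ (toricIdeal a)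

/-- The image of the variable `uᵢ` in the coordinate ring `ℂ[u₁, …, uₙ] / I_A`. -/
def coord {n d : ℕ} (a : Fin n → Fin d → ℤ) (i : Fin n) :
    MvPolynomial (Fin n) ℂ ⧸ toricIdeal a :=
  Ideal.Quotient.mk (toricIdeal a) (MvPolynomial.X i)

/-- The logarithmic Jacobian ideal: generated by the products of `d` coordinates whose vectors
have nonzero determinant. -/
def logJacobianIdeal {n d : ℕ} (a : Fin n → Fin d → ℤ) :
    Ideal (MvPolynomial (Fin n) ℂ ⧸ toricIdeal a) :=
  Ideal.span {f | ∃ j : Fin d → Fin n,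
    (Matrix.of fun r => a (j r)).det ≠ 0 ∧ f = ∏ r, coord a (j r)}

/-- Integers `a₁, …, aₙ` as vectors in `ℤ¹`, the case of toric curves. -/
def curveVectors {n : ℕ} (a : Fin n → ℤ) : Fin n → Fin 1 → ℤ := fun i _ => a i

end ToricNash

end

open scoped LinearAlgebra.Projectivization

noncomputable section

namespace ToricNash

/-! Write `b` for the exponents. Coprimality makes the curve the image of `t ↦ (t ^ b₁, …, t ^ bₙ)`,
so it has dimension one. It is stable under `x ↦ (xᵢ s ^ bᵢ)`, and the velocity of this orbit at `s
= 1` is the tangent vector `(bᵢ xᵢ)`. Off the origin, the binomials `uᵢ ^ bⱼ - uⱼ ^ bᵢ` leave no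
other tangent direction (`tangentSpace_toricCurve`). Hence only the origin can be singular, and by
assumption it is.

The Gauss map is therefore `x ↦ [b₁ x₁ : ⋯ : bₙ xₙ]`, which differs by an invertible diagonal matrix
from the map `[x₁ : ⋯ : xₙ]` of the ideal generated by the coordinates. Two generating systems of
one ideal are related on the curve by polynomial matrices in both directions, and
`isomorphicOver_closure_projGraph` turns such matrices into an isomorphism of the closures of the
graphs. -/

/-! ### Polynomial matrices acting on `ℂⁿ × ℙᵐ⁻¹` -/

/-- The graph in `ℂⁿ × ℙᵐ⁻¹` of `x ↦ [g₁(x) : ⋯ : gₘ(x)]`, over the points of `S` at which `g` does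
not vanish. -/
def projGraph {n m : ℕ} (S : Set (Fin n → ℂ)) (g : (Fin n → ℂ) → Fin m → ℂ) :
    Set (AffProj n m) :=
  {z | z.aff ∈ S ∧ ∃ h : g z.aff ≠ 0, z.proj = Projectivization.mk ℂ (g z.aff) h}

/-- The value at `x ∈ ℂⁿ` of a matrix of polynomials. -/
def matrixAt {n m k : ℕ} (M : Matrix (Fin k) (Fin m) (MvPolynomial (Fin n) ℂ))
    (x : Fin n → ℂ) : Matrix (Fin k) (Fin m) ℂ :=
  M.map (MvPolynomial.eval x)

/-- The linear forms in `T₁, …, Tₘ` given by the rows of a matrix of polynomials. -/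
def rowForm {n m k : ℕ} (M : Matrix (Fin k) (Fin m) (MvPolynomial (Fin n) ℂ)) (i : Fin k) :
    MvPolynomial (Fin m) (MvPolynomial (Fin n) ℂ) :=
  ∑ j, MvPolynomial.C (M i j) * MvPolynomial.X j

/-- The substitution of the row forms of `M` for the homogeneous coordinates. -/
def substRows {n m k : ℕ} (M : Matrix (Fin k) (Fin m) (MvPolynomial (Fin n) ℂ))
    (F : MvPolynomial (Fin k) (MvPolynomial (Fin n) ℂ)) :
    MvPolynomial (Fin m) (MvPolynomial (Fin n) ℂ) :=
  MvPolynomial.aeval (rowForm M) F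

theorem rowForm_isHomogeneous {n m k : ℕ} (M : Matrix (Fin k) (Fin m) (MvPolynomial (Fin n) ℂ))
    (i : Fin k) : (rowForm M i).IsHomogeneous 1 :=
  MvPolynomial.IsHomogeneous.sum _ _ _ fun j _ => by
    simpa using (MvPolynomial.isHomogeneous_C (Fin m) (M i j)).mul
      (MvPolynomial.isHomogeneous_X (MvPolynomial (Fin n) ℂ) j)

theorem substRows_isHomogeneous {n m k d : ℕ}
    (M : Matrix (Fin k) (Fin m) (MvPolynomial (Fin n) ℂ))
    {F : MvPolynomial (Fin k) (MvPolynomial (Fin n) ℂ)} (hF : F.IsHomogeneous d) :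
    (substRows M F).IsHomogeneous d := by
  simpa [substRows] using hF.aeval (rowForm M) (rowForm_isHomogeneous M)

theorem eval₂_rowForm {n m k : ℕ} (M : Matrix (Fin k) (Fin m) (MvPolynomial (Fin n) ℂ))
    (x : Fin n → ℂ) (v : Fin m → ℂ) (i : Fin k) :
    MvPolynomial.eval₂ (MvPolynomial.eval x) v (rowForm M i) = (matrixAt M x).mulVec v i := by
  simp [rowForm, matrixAt, Matrix.mulVec, dotProduct, MvPolynomial.eval₂_sum,
    MvPolynomial.eval₂_mul]

theorem eval₂_substRows {n m k : ℕ} (M : Matrix (Fin k) (Fin m) (MvPolynomial (Fin n) ℂ))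
    (F : MvPolynomial (Fin k) (MvPolynomial (Fin n) ℂ)) (x : Fin n → ℂ) (v : Fin m → ℂ) :
    MvPolynomial.eval₂ (MvPolynomial.eval x) v (substRows M F) =
      MvPolynomial.eval₂ (MvPolynomial.eval x) ((matrixAt M x).mulVec v) F := by
  induction F using MvPolynomial.induction_on with
  | C c => simp [substRows]
  | add p q hp hq =>
    simp only [substRows] at hp hq ⊢
    rw [map_add, MvPolynomial.eval₂_add, hp, hq, MvPolynomial.eval₂_add]
  | mul_X p i hp =>
    simp only [substRows] at hp ⊢
    rw [map_mul, MvPolynomial.eval₂_mul, hp, MvPolynomial.eval₂_mul, MvPolynomial.aeval_X,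
      eval₂_rowForm, MvPolynomial.eval₂_X]

theorem eval₂_smul_of_isHomogeneous {R : Type*} [CommSemiring R] {m d : ℕ} (φ : R →+* ℂ)
    {F : MvPolynomial (Fin m) R} (hF : F.IsHomogeneous d) (c : ℂ) (v : Fin m → ℂ) :
    MvPolynomial.eval₂ φ (c • v) F = c ^ d * MvPolynomial.eval₂ φ v F := by
  rw [MvPolynomial.eval₂_eq, MvPolynomial.eval₂_eq, Finset.mul_sum]
  refine Finset.sum_congr rfl fun s hs => ?_
  have hd : ∑ i ∈ s.support, s i = d := by
    have := hF (MvPolynomial.mem_support_iff.1 hs)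
    simpa [Finsupp.weight_apply, Finsupp.sum] using this
  simp only [Pi.smul_apply, smul_eq_mul, mul_pow, Finset.prod_mul_distrib,
    Finset.prod_pow_eq_pow_sum, hd]
  ring

/-- The chosen representative is `c • v`. One `c` serves all `d` and `F`, so it cancels from
quotients of forms of equal degree. -/
theorem exists_value_mk_eq {n m : ℕ} (x : Fin n → ℂ) (v : Fin m → ℂ) (hv : v ≠ 0) :
    ∃ c : ℂ, c ≠ 0 ∧ ∀ (d : ℕ) (F : MvPolynomial (Fin m) (MvPolynomial (Fin n) ℂ)),
      F.IsHomogeneous d → AffProj.value F ((x, Projectivization.mk ℂ v hv) : AffProj n m) =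
        c ^ d * MvPolynomial.eval₂ (MvPolynomial.eval x) v F := by
  obtain ⟨c, hc⟩ := Projectivization.exists_smul_eq_mk_rep ℂ v hv
  refine ⟨c, c.ne_zero, fun d F hF => ?_⟩
  rw [← eval₂_smul_of_isHomogeneous _ hF]
  change MvPolynomial.eval₂ _ (Projectivization.mk ℂ v hv).rep F = _
  rw [← hc]
  rfl

theorem isOpen_value_ne_zero {n m d : ℕ} {F : MvPolynomial (Fin m) (MvPolynomial (Fin n) ℂ)}
    (hF : F.IsHomogeneous d) : IsOpen {z : AffProj n m | AffProj.value F z ≠ 0} :=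
  TopologicalSpace.isOpen_generateFrom_of_mem ⟨d, F, hF, rfl⟩

theorem isClosed_value_eq_zero {n m d : ℕ} {F : MvPolynomial (Fin m) (MvPolynomial (Fin n) ℂ)}
    (hF : F.IsHomogeneous d) : IsClosed {z : AffProj n m | AffProj.value F z = 0} :=
  ⟨isOpen_value_ne_zero hF⟩

/-- The map `(x, [v]) ↦ (x, [M(x) v])`, where it is defined. -/
def transform {n m k : ℕ} (M : Matrix (Fin k) (Fin m) (MvPolynomial (Fin n) ℂ)) (z : AffProj n m)
    (h : (matrixAt M z.aff).mulVec z.proj.rep ≠ 0) : AffProj n k :=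
  (z.aff, Projectivization.mk ℂ _ h)

theorem exists_value_transform_eq {n m k : ℕ}
    (M : Matrix (Fin k) (Fin m) (MvPolynomial (Fin n) ℂ)) (z : AffProj n m)
    (h : (matrixAt M z.aff).mulVec z.proj.rep ≠ 0) :
    ∃ c : ℂ, c ≠ 0 ∧ ∀ (d : ℕ) (F : MvPolynomial (Fin k) (MvPolynomial (Fin n) ℂ)),
      F.IsHomogeneous d →
        AffProj.value F (transform M z h) = c ^ d * AffProj.value (substRows M F) z := by
  obtain ⟨c, hc, hF⟩ := exists_value_mk_eq z.aff _ h
  refine ⟨c, hc, fun d F hd => ?_⟩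
  rw [transform, hF d F hd, AffProj.value, eval₂_substRows]

theorem continuous_transform {n m k : ℕ} {Z : Set (AffProj n m)}
    (M : Matrix (Fin k) (Fin m) (MvPolynomial (Fin n) ℂ))
    (h : ∀ z ∈ Z, (matrixAt M z.aff).mulVec z.proj.rep ≠ 0) :
    Continuous fun z : Z => transform M z.1 (h z.1 z.2) := by
  refine continuous_generateFrom_iff.2 ?_
  rintro _ ⟨d, F, hF, rfl⟩
  convert (isOpen_value_ne_zero (substRows_isHomogeneous M hF)).preimage
    (continuous_subtype_val (p := (· ∈ Z))) using 1
  ext z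
  obtain ⟨c, hc, hv⟩ := exists_value_transform_eq M z.1 (h z.1 z.2)
  simp [hv d F hF, hc]

/-- The equations `P(x) T = T` are linear forms in `T`, hence closed conditions: holding on the
graph, they persist on its closure, even over points where `g` vanishes. -/
theorem mulVec_rep_eq_of_mem_closure_projGraph {n m : ℕ} {S : Set (Fin n → ℂ)}
    {g : (Fin n → ℂ) → Fin m → ℂ} {P : Matrix (Fin m) (Fin m) (MvPolynomial (Fin n) ℂ)}
    (hP : ∀ x ∈ S, (matrixAt P x).mulVec (g x) = g x) {z : AffProj n m}
    (hz : z ∈ closure (projGraph S g)) : (matrixAt P z.aff).mulVec z.proj.rep = z.proj.rep := by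
  funext i
  have hF : (rowForm P i - MvPolynomial.X i).IsHomogeneous 1 :=
    (rowForm_isHomogeneous P i).sub (MvPolynomial.isHomogeneous_X _ i)
  have hsub : projGraph S g ⊆ {z | AffProj.value (rowForm P i - MvPolynomial.X i) z = 0} := by
    rintro ⟨x, p⟩ ⟨hx, hg, hp⟩
    obtain ⟨c, -, hc⟩ := exists_value_mk_eq x (g x) hg
    change p = Projectivization.mk ℂ (g x) hg at hp
    change AffProj.value _ ((x, p) : AffProj n m) = 0
    rw [hp, hc 1 _ hF, MvPolynomial.eval₂_sub, eval₂_rowForm, MvPolynomial.eval₂_X, hP x hx]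
    simp
  have := closure_minimal hsub (isClosed_value_eq_zero hF) hz
  simpa [AffProj.value, MvPolynomial.eval₂_sub, eval₂_rowForm, sub_eq_zero] using this

theorem matrixAt_mul {n m k l : ℕ} (N : Matrix (Fin l) (Fin k) (MvPolynomial (Fin n) ℂ))
    (M : Matrix (Fin k) (Fin m) (MvPolynomial (Fin n) ℂ)) (x : Fin n → ℂ) :
    matrixAt (N * M) x = matrixAt N x * matrixAt M x :=
  Matrix.map_mul

theorem mulVec_mulVec_rep_eq_of_mem_closure_projGraph {n m k : ℕ} {S : Set (Fin n → ℂ)}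
    {g : (Fin n → ℂ) → Fin m → ℂ} {f : (Fin n → ℂ) → Fin k → ℂ}
    {M : Matrix (Fin k) (Fin m) (MvPolynomial (Fin n) ℂ)}
    {N : Matrix (Fin m) (Fin k) (MvPolynomial (Fin n) ℂ)}
    (hM : ∀ x ∈ S, (matrixAt M x).mulVec (g x) = f x)
    (hN : ∀ x ∈ S, (matrixAt N x).mulVec (f x) = g x) {z : AffProj n m}
    (hz : z ∈ closure (projGraph S g)) :
    (matrixAt N z.aff).mulVec ((matrixAt M z.aff).mulVec z.proj.rep) = z.proj.rep := by
  have := mulVec_rep_eq_of_mem_closure_projGraph (P := N * M) (fun x hx => by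
    rw [matrixAt_mul, ← Matrix.mulVec_mulVec, hM x hx, hN x hx]) hz
  rwa [matrixAt_mul, ← Matrix.mulVec_mulVec] at this

/-- Since `N M` fixes the representative, `M` cannot kill it. Thus `transform M` is defined on the
whole closure. -/
theorem mulVec_rep_ne_zero_of_mem_closure_projGraph {n m k : ℕ} {S : Set (Fin n → ℂ)}
    {g : (Fin n → ℂ) → Fin m → ℂ} {f : (Fin n → ℂ) → Fin k → ℂ}
    {M : Matrix (Fin k) (Fin m) (MvPolynomial (Fin n) ℂ)}
    {N : Matrix (Fin m) (Fin k) (MvPolynomial (Fin n) ℂ)}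
    (hM : ∀ x ∈ S, (matrixAt M x).mulVec (g x) = f x)
    (hN : ∀ x ∈ S, (matrixAt N x).mulVec (f x) = g x) (z : AffProj n m)
    (hz : z ∈ closure (projGraph S g)) : (matrixAt M z.aff).mulVec z.proj.rep ≠ 0 := by
  intro h
  have := mulVec_mulVec_rep_eq_of_mem_closure_projGraph hM hN hz
  rw [h, Matrix.mulVec_zero] at this
  exact z.proj.rep_nonzero this.symm

theorem transform_mem_projGraph {n m k : ℕ} {S : Set (Fin n → ℂ)}
    {g : (Fin n → ℂ) → Fin m → ℂ} {f : (Fin n → ℂ) → Fin k → ℂ}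
    {M : Matrix (Fin k) (Fin m) (MvPolynomial (Fin n) ℂ)}
    (hM : ∀ x ∈ S, (matrixAt M x).mulVec (g x) = f x) {z : AffProj n m}
    (hz : z ∈ projGraph S g) (h : (matrixAt M z.aff).mulVec z.proj.rep ≠ 0) :
    transform M z h ∈ projGraph S f := by
  obtain ⟨hx, hg, hp⟩ := hz
  obtain ⟨c, hc⟩ := Projectivization.exists_smul_eq_mk_rep ℂ (g z.aff) hg
  have hv : (matrixAt M z.aff).mulVec z.proj.rep = (c : ℂ) • f z.aff := by
    rw [hp, ← hc, ← hM _ hx, ← Matrix.mulVec_smul]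
    rfl
  have hf : f z.aff ≠ 0 := fun h0 => h (by rw [hv, h0, smul_zero])
  exact ⟨hx, hf, (Projectivization.mk_eq_mk_iff' ℂ _ _ h hf).2 ⟨c, hv.symm⟩⟩

theorem transform_mem_closure_projGraph {n m k : ℕ} {S : Set (Fin n → ℂ)}
    {g : (Fin n → ℂ) → Fin m → ℂ} {f : (Fin n → ℂ) → Fin k → ℂ}
    {M : Matrix (Fin k) (Fin m) (MvPolynomial (Fin n) ℂ)}
    (hM : ∀ x ∈ S, (matrixAt M x).mulVec (g x) = f x)
    (h : ∀ z ∈ closure (projGraph S g), (matrixAt M z.aff).mulVec z.proj.rep ≠ 0)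
    (z : AffProj n m) (hz : z ∈ closure (projGraph S g)) :
    transform M z (h z hz) ∈ closure (projGraph S f) := by
  -- The closure is taken inside the subspace, because `transform M` is known to be defined only
  -- there.
  have hz' : (⟨z, hz⟩ : closure (projGraph S g)) ∈
      closure (Subtype.val ⁻¹' projGraph S g : Set (closure (projGraph S g))) := by
    rw [closure_subtype, Subtype.image_preimage_coe,
      Set.inter_eq_self_of_subset_right subset_closure]
    exact hz
  exact map_mem_closure (f := fun w : closure (projGraph S g) => transform M w.1 (h w.1 w.2))
    (continuous_transform M h) hz'
    fun w hw => transform_mem_projGraph hM hw (h w.1 w.2)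

theorem transform_transform {n m k : ℕ} {M : Matrix (Fin k) (Fin m) (MvPolynomial (Fin n) ℂ)}
    {N : Matrix (Fin m) (Fin k) (MvPolynomial (Fin n) ℂ)} {z : AffProj n m}
    (h : (matrixAt M z.aff).mulVec z.proj.rep ≠ 0)
    (hNM : (matrixAt N z.aff).mulVec ((matrixAt M z.aff).mulVec z.proj.rep) = z.proj.rep)
    (h' : (matrixAt N (transform M z h).aff).mulVec (transform M z h).proj.rep ≠ 0) :
    transform N (transform M z h) h' = z := by
  obtain ⟨c, hc⟩ := Projectivization.exists_smul_eq_mk_rep ℂ _ h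
  refine Prod.ext rfl ?_
  change Projectivization.mk ℂ _ h' = z.proj
  rw [← z.proj.mk_rep, Projectivization.mk_eq_mk_iff']
  refine ⟨c, ?_⟩
  change _ = (matrixAt N z.aff).mulVec (Projectivization.mk ℂ _ h).rep
  rw [← hc, Units.smul_def, Matrix.mulVec_smul, hNM]

theorem IsRegularOn.comp_transform {n m k : ℕ} {Z : Set (AffProj n m)} {W : Set (AffProj n k)}
    (M : Matrix (Fin k) (Fin m) (MvPolynomial (Fin n) ℂ))
    (h : ∀ z ∈ Z, (matrixAt M z.aff).mulVec z.proj.rep ≠ 0) {e : Z → W} (he : Continuous e)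
    (heM : ∀ z : Z, (e z).1 = transform M z.1 (h z.1 z.2)) {V : Set W} {g : W → ℂ}
    (hg : IsRegularOn V g) : IsRegularOn (e ⁻¹' V) (g ∘ e) := by
  intro z hz
  obtain ⟨U, hU, hzU, hUV, d, F, G, hF, hG, hFG⟩ := hg (e z) hz
  refine ⟨e ⁻¹' U, hU.preimage he, hzU, Set.preimage_mono hUV, d, substRows M F, substRows M G,
    substRows_isHomogeneous M hF, substRows_isHomogeneous M hG, fun w hw => ?_⟩
  obtain ⟨hne, hq⟩ := hFG (e w) hw
  obtain ⟨c, hc, hv⟩ := exists_value_transform_eq M w.1 (h w.1 w.2)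
  rw [heM, hv d G hG] at hne
  rw [heM, hv d F hF, hv d G hG, mul_div_mul_left _ _ (pow_ne_zero d hc)] at hq
  exact ⟨right_ne_zero_of_mul hne, hq⟩

/-- The closures of the graphs of `[g]` and `[f]` are isomorphic if `g` and `f` are obtained from
each other by polynomial matrices. -/
theorem isomorphicOver_closure_projGraph {n m k : ℕ} {S : Set (Fin n → ℂ)}
    {g : (Fin n → ℂ) → Fin m → ℂ} {f : (Fin n → ℂ) → Fin k → ℂ}
    (M : Matrix (Fin k) (Fin m) (MvPolynomial (Fin n) ℂ))
    (N : Matrix (Fin m) (Fin k) (MvPolynomial (Fin n) ℂ))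
    (hM : ∀ x ∈ S, (matrixAt M x).mulVec (g x) = f x)
    (hN : ∀ x ∈ S, (matrixAt N x).mulVec (f x) = g x) :
    IsomorphicOver (closure (projGraph S g)) (closure (projGraph S f)) := by
  have hg := mulVec_rep_ne_zero_of_mem_closure_projGraph hM hN
  have hf := mulVec_rep_ne_zero_of_mem_closure_projGraph hN hM
  let e : closure (projGraph S g) ≃ₜ closure (projGraph S f) :=
    { toFun := fun z => ⟨transform M z.1 (hg z.1 z.2),
        transform_mem_closure_projGraph hM hg z.1 z.2⟩
      invFun := fun z => ⟨transform N z.1 (hf z.1 z.2),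
        transform_mem_closure_projGraph hN hf z.1 z.2⟩
      left_inv := fun z => Subtype.ext <| transform_transform _
        (mulVec_mulVec_rep_eq_of_mem_closure_projGraph hM hN z.2) _
      right_inv := fun z => Subtype.ext <| transform_transform _
        (mulVec_mulVec_rep_eq_of_mem_closure_projGraph hN hM z.2) _
      continuous_toFun := (continuous_transform M hg).subtype_mk _
      continuous_invFun := (continuous_transform N hf).subtype_mk _ }
  refine ⟨e, fun z => rfl, fun V _ φ => ⟨fun h => ?_, fun h => ?_⟩⟩
  · exact h.comp_transform M hg e.continuous fun z => rfl
  · have := h.comp_transform N hf e.symm.continuous fun z => rfl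
    rwa [Function.comp_assoc, e.self_comp_symm, Function.comp_id, ← Set.preimage_comp,
      e.self_comp_symm, Set.preimage_id] at this

/-! ### Krull dimension one -/

/-- A nonzero prime of `R` is the contraction of a nonzero prime of `S`, which is maximal in a
principal ideal domain; contraction along an integral map keeps it maximal. In dimension zero `R`
would be a field, and then so would `S`. -/
theorem ringKrullDim_eq_one_of_isIntegral {R S : Type*} [CommRing R] [CommRing S] [IsDomain S]
    [IsPrincipalIdealRing S] (hS : ¬ IsField S) (f : R →+* S) (hf : Function.Injective f)
    (hint : f.IsIntegral) : ringKrullDim R = 1 := by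
  algebraize [f]
  have : Algebra.IsIntegral R S := ⟨hint⟩
  have : IsDomain R := hf.isDomain f
  have : Ring.DimensionLEOne R := ⟨fun {p} hp hprime => by
    obtain ⟨Q, hQ, hQp⟩ := Ideal.exists_ideal_over_prime_of_isIntegral_of_isDomain (S := S) p
      (by
        have : RingHom.ker (algebraMap R S) = ⊥ := (RingHom.injective_iff_ker_eq_bot f).1 hf
        simp [this])
    have hQ0 : Q ≠ ⊥ := by
      rintro rfl
      refine hp (hQp.symm.trans ?_)
      exact (RingHom.injective_iff_ker_eq_bot f).1 hf
    have := hQ.isMaximal hQ0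
    exact hQp ▸ Ideal.isMaximal_comap_of_isIntegral_of_isMaximal Q⟩
  apply eq_of_le_of_not_lt
  · rw [← Nat.cast_one, ← Ring.krullDimLE_iff]
    infer_instance
  · intro h
    have h0 : ringKrullDim R ≤ 0 := Order.le_of_lt_succ h
    rw [← Nat.cast_zero, ← Ring.krullDimLE_iff] at h0
    exact hS (isField_of_isIntegral_of_isField' (R := R) Ring.KrullDimLE.isField_of_isDomain)

theorem isIntegral_of_X_pow_mem_range {R : Type*} [CommRing R] (f : R →+* Polynomial ℂ) {d : ℕ}
    (hd : 0 < d) (hX : (Polynomial.X : Polynomial ℂ) ^ d ∈ f.range)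
    (hC : ∀ c, Polynomial.C c ∈ f.range) : f.IsIntegral := by
  algebraize [f]
  have hmem : ∀ p ∈ f.range, IsIntegral R p := by
    rintro _ ⟨r, rfl⟩
    exact isIntegral_algebraMap (R := R) (A := Polynomial ℂ) (x := r)
  have hXint : IsIntegral R (Polynomial.X : Polynomial ℂ) := IsIntegral.of_pow hd (hmem _ hX)
  intro p
  change IsIntegral R p
  induction p using Polynomial.induction_on' with
  | add p q hp hq => exact hp.add hq
  | monomial k c =>
    rw [← Polynomial.C_mul_X_pow_eq_monomial]
    exact (hmem _ (hC c)).mul (hXint.pow k)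

/-! ### The chain rule along a curve -/

theorem derivative_aeval {n : ℕ} (q : Fin n → Polynomial ℂ) (F : MvPolynomial (Fin n) ℂ) :
    Polynomial.derivative (MvPolynomial.aeval q F) =
      ∑ i, Polynomial.derivative (q i) * MvPolynomial.aeval q (MvPolynomial.pderiv i F) := by
  induction F using MvPolynomial.induction_on with
  | C c => simp
  | add F G hF hG => simp [hF, hG, mul_add, Finset.sum_add_distrib]
  | mul_X F j hF =>
    have hterm : ∀ i, MvPolynomial.aeval q (MvPolynomial.pderiv i (F * MvPolynomial.X j)) =
        MvPolynomial.aeval q (MvPolynomial.pderiv i F) * q j +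
          if i = j then MvPolynomial.aeval q F else 0 := by
      intro i
      rw [MvPolynomial.pderiv_mul, map_add, map_mul, map_mul, MvPolynomial.aeval_X]
      split_ifs with hij
      · rw [hij, MvPolynomial.pderiv_X_self, map_one, mul_one]
      · rw [MvPolynomial.pderiv_X_of_ne (Ne.symm hij), map_zero, mul_zero]
    rw [map_mul, MvPolynomial.aeval_X, Polynomial.derivative_mul, hF]
    simp only [hterm, mul_add, Finset.sum_add_distrib, mul_ite, mul_zero, Finset.sum_ite_eq',
      Finset.mem_univ, if_true, ← mul_assoc, ← Finset.sum_mul]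
    rw [mul_comm (Polynomial.derivative (q j))]

theorem eval_aeval_polynomial {n : ℕ} (q : Fin n → Polynomial ℂ) (F : MvPolynomial (Fin n) ℂ)
    (s : ℂ) : (MvPolynomial.aeval q F).eval s =
      MvPolynomial.aeval (fun i => (q i).eval s) F := by
  have := MvPolynomial.comp_aeval_apply (φ := Polynomial.aeval (R := ℂ) s) q F
  simpa [Polynomial.coe_aeval_eq_eval] using this

/-! ### Toric curves -/

/-- The toric curve of the positive integers `b₁, …, bₙ`. -/
abbrev toricCurve {n : ℕ} (b : Fin n → ℕ) : Set (Fin n → ℂ) :=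
  toricVariety (curveVectors fun i => (b i : ℤ))

theorem mem_toricCurve_iff {n : ℕ} {b : Fin n → ℕ} {x : Fin n → ℂ} :
    x ∈ toricCurve b ↔ ∀ α β : Fin n →₀ ℕ, ∑ i, α i * b i = ∑ i, β i * b i →
      ∏ i, x i ^ α i = ∏ i, x i ^ β i := by
  have key : ∀ α β : Fin n →₀ ℕ,
      (∑ i, α i • curveVectors (fun i => (b i : ℤ)) i =
        ∑ i, β i • curveVectors (fun i => (b i : ℤ)) i) ↔
      ∑ i, α i * b i = ∑ i, β i * b i := by
    intro α β
    rw [funext_iff, Fin.forall_fin_one, Finset.sum_apply, Finset.sum_apply]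
    simp only [curveVectors, Pi.smul_apply, nsmul_eq_mul]
    norm_cast
  rw [toricCurve, toricVariety, toricIdeal, MvPolynomial.zeroLocus_span]
  constructor
  · intro h α β hαβ
    have := h _ ⟨α, β, (key α β).2 hαβ, rfl⟩
    simpa [MvPolynomial.eval_monomial, Finsupp.prod_fintype, sub_eq_zero] using this
  · rintro h _ ⟨α, β, hαβ, rfl⟩
    simpa [MvPolynomial.eval_monomial, Finsupp.prod_fintype, sub_eq_zero] using
      h α β ((key α β).1 hαβ)

/-- Both monomials of a defining binomial have the same weight, so they acquire the same power of
`s`. -/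
theorem smul_mem_toricCurve {n : ℕ} {b : Fin n → ℕ} {x : Fin n → ℂ} (hx : x ∈ toricCurve b)
    (s : ℂ) : (fun i => x i * s ^ b i) ∈ toricCurve b := by
  rw [mem_toricCurve_iff] at hx ⊢
  intro α β h
  simp only [mul_pow, Finset.prod_mul_distrib, hx α β h, ← pow_mul, Finset.prod_pow_eq_pow_sum,
    mul_comm (b _), h]

theorem pow_mem_toricCurve {n : ℕ} (b : Fin n → ℕ) (s : ℂ) :
    (fun i => s ^ b i) ∈ toricCurve b := by
  have h1 : (fun _ => 1 : Fin n → ℂ) ∈ toricCurve b := by simp [mem_toricCurve_iff]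
  simpa using smul_mem_toricCurve h1 s

theorem zero_mem_toricCurve {n : ℕ} {b : Fin n → ℕ} (hb : ∀ i, 0 < b i) :
    (0 : Fin n → ℂ) ∈ toricCurve b := by
  convert pow_mem_toricCurve b 0 using 1
  funext i
  simp [(hb i).ne']

theorem pow_eq_pow_of_mem_toricCurve {n : ℕ} {b : Fin n → ℕ} {x : Fin n → ℂ}
    (hx : x ∈ toricCurve b) (i j : Fin n) : x i ^ b j = x j ^ b i := by
  have := mem_toricCurve_iff.1 hx (Finsupp.single i (b j)) (Finsupp.single j (b i))
    (by simp [Finsupp.single_apply, mul_comm])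
  simpa [Finsupp.single_apply] using this

theorem apply_ne_zero_of_mem_toricCurve {n : ℕ} {b : Fin n → ℕ} (hb : ∀ i, 0 < b i)
    {x : Fin n → ℂ} (hx : x ∈ toricCurve b) (hx0 : x ≠ 0) (i : Fin n) : x i ≠ 0 := by
  obtain ⟨j, hj⟩ := Function.ne_iff.1 hx0
  intro hi
  have := pow_eq_pow_of_mem_toricCurve hx i j
  rw [hi, zero_pow (hb j).ne'] at this
  exact pow_ne_zero _ hj this.symm

theorem zpow_sum₀ {ι K : Type*} [Field K] {t : K} (ht : t ≠ 0) (s : Finset ι) (c : ι → ℤ) :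
    t ^ (∑ i ∈ s, c i) = ∏ i ∈ s, t ^ c i := by
  classical
  induction s using Finset.induction_on with
  | empty => simp
  | insert i s hi ih => rw [Finset.sum_insert hi, Finset.prod_insert hi, zpow_add₀ ht, ih]

/-- A toric curve with coprime exponents is the image of `t ↦ (t ^ b₁, …, t ^ bₙ)`. -/
theorem exists_eq_pow_of_mem_toricCurve {n : ℕ} {b : Fin n → ℕ} (hb : ∀ i, 0 < b i)
    (hgcd : Finset.univ.gcd (fun i => (b i : ℤ)) = 1) {x : Fin n → ℂ} (hx : x ∈ toricCurve b) :
    ∃ t : ℂ, x = fun i => t ^ b i := by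
  by_cases hx0 : x = 0
  · refine ⟨0, ?_⟩
    funext i
    simp [hx0, (hb i).ne']
  · have hne := apply_ne_zero_of_mem_toricCurve hb hx hx0
    obtain ⟨c, hc⟩ := Finset.gcd_eq_sum_mul Finset.univ (fun i => (b i : ℤ))
    rw [hgcd] at hc
    -- With the Bézout relation `∑ bᵢ cᵢ = 1`, the point `(t ^ bᵢ)` gives back `∏ (t ^ bᵢ) ^ cᵢ =
    -- t`. Some `cᵢ` may be negative, whence the separate case of the origin.
    refine ⟨∏ i, x i ^ c i, ?_⟩
    funext j
    calc x j = x j ^ (∑ i, (b i : ℤ) * c i) := by rw [← hc, zpow_one]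
      _ = ∏ i, x j ^ ((b i : ℤ) * c i) := zpow_sum₀ (hne j) _ _
      _ = ∏ i, (x i ^ c i) ^ b j := by
        refine Finset.prod_congr rfl fun i _ => ?_
        rw [zpow_mul, zpow_natCast, ← pow_eq_pow_of_mem_toricCurve hx i j, ← zpow_natCast,
          ← zpow_mul, mul_comm, zpow_mul, zpow_natCast]
      _ = (∏ i, x i ^ c i) ^ b j := Finset.prod_pow _ _ _

/-! ### Coordinate ring and dimension of the curve. -/

/-- The parametrization is onto the curve, and a polynomial in one variable over `ℂ` is zero once
all its values are. The ring of functions thus embeds in `ℂ[X]`. -/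
theorem mem_vanishingIdeal_toricCurve_iff {n : ℕ} {b : Fin n → ℕ} (hb : ∀ i, 0 < b i)
    (hgcd : Finset.univ.gcd (fun i => (b i : ℤ)) = 1) {F : MvPolynomial (Fin n) ℂ} :
    F ∈ MvPolynomial.vanishingIdeal ℂ (toricCurve b) ↔
      MvPolynomial.aeval (fun i => (Polynomial.X : Polynomial ℂ) ^ b i) F = 0 := by
  constructor
  · intro h
    refine Polynomial.funext fun s => ?_
    rw [eval_aeval_polynomial]
    simpa using h _ (pow_mem_toricCurve b s)
  · intro h x hx
    obtain ⟨t, rfl⟩ := exists_eq_pow_of_mem_toricCurve hb hgcd hx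
    have := eval_aeval_polynomial (fun i => (Polynomial.X : Polynomial ℂ) ^ b i) F t
    rw [h] at this
    simpa using this.symm

theorem dimension_toricCurve {n : ℕ} {b : Fin n → ℕ} (hb : ∀ i, 0 < b i)
    (hgcd : Finset.univ.gcd (fun i => (b i : ℤ)) = 1) : dimension (toricCurve b) = 1 := by
  have hker := fun F => mem_vanishingIdeal_toricCurve_iff hb hgcd (F := F)
  -- The gcd of the empty family is `0`, not `1`.
  have hn : Nonempty (Fin n) := by
    by_contra h
    rw [not_nonempty_iff] at h
    simp at hgcd
  obtain ⟨i⟩ := hn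
  let φ : MvPolynomial (Fin n) ℂ →+* Polynomial ℂ :=
    (MvPolynomial.aeval fun i => (Polynomial.X : Polynomial ℂ) ^ b i).toRingHom
  let ψ := Ideal.Quotient.lift (MvPolynomial.vanishingIdeal ℂ (toricCurve b)) φ
    fun F hF => (hker F).1 hF
  have hrange : ∀ F, φ F ∈ ψ.range := fun F => ⟨Ideal.Quotient.mk _ F, rfl⟩
  refine ringKrullDim_eq_one_of_isIntegral (Polynomial.not_isField ℂ) ψ ?_ ?_
  · rw [injective_iff_map_eq_zero]
    intro r hr
    obtain ⟨F, rfl⟩ := Ideal.Quotient.mk_surjective r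
    exact Ideal.Quotient.eq_zero_iff_mem.2 ((hker F).2 hr)
  · refine isIntegral_of_X_pow_mem_range ψ (hb i) ?_ fun c => ?_
    · simpa [φ] using hrange (MvPolynomial.X i)
    · simpa [φ, Polynomial.algebraMap_apply] using hrange (MvPolynomial.C c)

/-! ### Tangent lines, singular locus and Gauss map. -/

/-- Differentiate `F(x₁ s ^ b₁, …, xₙ s ^ bₙ) = 0` at `s = 1`. -/
theorem mul_mem_tangentSpace_toricCurve {n : ℕ} {b : Fin n → ℕ} {x : Fin n → ℂ}
    (hx : x ∈ toricCurve b) : (fun i => (b i : ℂ) * x i) ∈ tangentSpace (toricCurve b) x := by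
  intro F hF
  have h0 : MvPolynomial.aeval
      (fun i => Polynomial.C (x i) * (Polynomial.X : Polynomial ℂ) ^ b i) F = 0 := by
    refine Polynomial.funext fun s => ?_
    rw [eval_aeval_polynomial]
    simpa using hF _ (smul_mem_toricCurve hx s)
  have h1 := congrArg (Polynomial.eval 1) (derivative_aeval
    (fun i => Polynomial.C (x i) * (Polynomial.X : Polynomial ℂ) ^ b i) F)
  rw [h0] at h1
  simp only [Polynomial.derivative_zero, Polynomial.eval_zero, Polynomial.eval_finsetSum,
    Polynomial.eval_mul, eval_aeval_polynomial] at h1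
  simp only [Polynomial.derivative_mul, Polynomial.derivative_C, Polynomial.derivative_X_pow,
    Polynomial.eval_mul, Polynomial.eval_C, Polynomial.eval_pow, Polynomial.eval_X, one_pow,
    mul_one, zero_mul, zero_add] at h1
  rw [h1]
  refine Finset.sum_congr rfl fun i _ => ?_
  rw [mul_comm (x i)]
  rfl

theorem tangentSpace_toricCurve {n : ℕ} {b : Fin n → ℕ} (hb : ∀ i, 0 < b i)
    {x : Fin n → ℂ} (hx : x ∈ toricCurve b) (hx0 : x ≠ 0) :
    tangentSpace (toricCurve b) x = Submodule.span ℂ {fun i => (b i : ℂ) * x i} := by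
  apply le_antisymm
  · intro v hv
    have hne := apply_ne_zero_of_mem_toricCurve hb hx hx0
    have hbne : ∀ i, (b i : ℂ) ≠ 0 := fun i => Nat.cast_ne_zero.2 (hb i).ne'
    obtain ⟨j, -⟩ := Function.ne_iff.1 hx0
    -- The differential of `uᵢ ^ bⱼ - uⱼ ^ bᵢ` makes `v` proportional to `(bᵢ xᵢ)`.
    have hrel : ∀ i, v i * (b j : ℂ) * x j = v j * (b i : ℂ) * x i := by
      intro i
      rcases eq_or_ne i j with rfl | hij
      · rfl
      have hF : MvPolynomial.X i ^ b j - MvPolynomial.X j ^ b i ∈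
          MvPolynomial.vanishingIdeal ℂ (toricCurve b) := fun y hy => by
        simp [pow_eq_pow_of_mem_toricCurve hy i j]
      have h := hv _ hF
      have hsum : v i * ((b j : ℂ) * x i ^ (b j - 1)) = v j * ((b i : ℂ) * x j ^ (b i - 1)) := by
        simp only [map_sub, MvPolynomial.pderiv_pow, MvPolynomial.pderiv_X, map_mul, map_natCast,
          map_pow, MvPolynomial.eval_X, Pi.single_apply, mul_sub, Finset.sum_sub_distrib,
          apply_ite (MvPolynomial.eval x), map_zero, mul_ite, mul_one, mul_zero,
          Finset.sum_ite_eq, Finset.mem_univ, if_true, sub_eq_zero] at h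
        exact h
      have hi : x i ^ (b j - 1) * x i = x i ^ b j := pow_sub_one_mul (hb j).ne' _
      have hj : x j ^ (b i - 1) * x j = x i ^ b j := by
        rw [pow_sub_one_mul (hb i).ne', pow_eq_pow_of_mem_toricCurve hx i j]
      -- Multiplying `hsum` by `xᵢ xⱼ` restores the lowered exponents; the common factor `xᵢ ^ bⱼ =
      -- xⱼ ^ bᵢ` then cancels.
      apply mul_right_cancel₀ (pow_ne_zero (b j) (hne i))
      linear_combination (x i * x j) * hsum - v i * b j * x j * hi + v j * b i * x i * hj
    refine Submodule.mem_span_singleton.2 ⟨v j / (b j * x j), ?_⟩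
    funext i
    have := hrel i
    have h1 := hbne j
    have h2 := hne j
    simp only [Pi.smul_apply, smul_eq_mul]
    field_simp
    linear_combination -this
  · rw [Submodule.span_singleton_le_iff_mem]
    exact mul_mem_tangentSpace_toricCurve hx

theorem mul_ne_zero_iff_of_pos {n : ℕ} {b : Fin n → ℕ} (hb : ∀ i, 0 < b i) {x : Fin n → ℂ} :
    (fun i => (b i : ℂ) * x i) ≠ 0 ↔ x ≠ 0 := by
  simp [funext_iff, fun i => (hb i).ne']

/-- Only an inclusion: the origin is a smooth point when some `bᵢ = 1`. -/
theorem singularLocus_toricCurve_subset {n : ℕ} {b : Fin n → ℕ} (hb : ∀ i, 0 < b i)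
    (hgcd : Finset.univ.gcd (fun i => (b i : ℤ)) = 1) : singularLocus (toricCurve b) ⊆ {0} := by
  rintro x ⟨hx, hdim⟩
  by_contra hx0
  apply hdim
  rw [tangentSpace_toricCurve hb hx hx0, dimension_toricCurve hb hgcd,
    finrank_span_singleton ((mul_ne_zero_iff_of_pos hb).2 hx0)]
  rfl

/-- The left side omits the singular points and the right side the zeros of `(bᵢ xᵢ)`; both omit
exactly the origin. -/
theorem gaussGraph_toricCurve {n : ℕ} {b : Fin n → ℕ} (hb : ∀ i, 0 < b i)
    (hsing : singularLocus (toricCurve b) = {0}) :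
    gaussGraph (toricCurve b) = projGraph (toricCurve b) fun x i => (b i : ℂ) * x i := by
  ext z
  simp only [gaussGraph, projGraph, Set.mem_ofPred_eq, hsing, Set.mem_sdiff, Set.mem_singleton_iff,
    and_assoc]
  refine and_congr_right fun hx => ?_
  rw [← Ne, ← mul_ne_zero_iff_of_pos hb, ← exists_prop]
  refine exists_congr fun h => ?_
  rw [tangentSpace_toricCurve hb hx ((mul_ne_zero_iff_of_pos hb).1 h),
    ← Projectivization.submodule_mk _ h, Projectivization.submodule_injective.eq_iff]

/-! ### The logarithmic Jacobian ideal and its blowup. -/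

theorem logJacobianIdeal_curveVectors {n : ℕ} {a : Fin n → ℤ} (ha : ∀ i, 0 < a i) :
    logJacobianIdeal (curveVectors a) = Ideal.span (Set.range (coord (curveVectors a))) := by
  rw [logJacobianIdeal]
  congr 1
  ext f
  constructor
  · rintro ⟨j, -, rfl⟩
    exact ⟨j 0, by simp⟩
  · rintro ⟨i, rfl⟩
    exact ⟨fun _ => i, by simp [curveVectors, (ha i).ne'], by simp⟩

theorem evalAt_mk {n : ℕ} (I : Ideal (MvPolynomial (Fin n) ℂ)) (x : MvPolynomial.zeroLocus ℂ I)
    (F : MvPolynomial (Fin n) ℂ) : evalAt I x (Ideal.Quotient.mk I F) = MvPolynomial.eval x.1 F :=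
  rfl

theorem idealLocus_span_coord {n : ℕ} {b : Fin n → ℕ} (hb : ∀ i, 0 < b i) :
    idealLocus (Ideal.span (Set.range (coord (curveVectors fun i => (b i : ℤ))))) = {0} := by
  ext x
  constructor
  · rintro ⟨hx, h⟩
    funext i
    simpa [coord, evalAt_mk] using h _ (Ideal.subset_span ⟨i, rfl⟩)
  · rintro rfl
    refine ⟨zero_mem_toricCurve hb, fun f hf => ?_⟩
    have hle : Ideal.span (Set.range (coord (curveVectors fun i => (b i : ℤ)))) ≤
        RingHom.ker (evalAt _ ⟨0, zero_mem_toricCurve hb⟩) := by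
      rw [Ideal.span_le]
      rintro _ ⟨i, rfl⟩
      simp [coord, evalAt_mk, RingHom.mem_ker]
    exact hle hf

theorem blowup_mk_eq {n m : ℕ} (I : Ideal (MvPolynomial (Fin n) ℂ))
    (F : Fin m → MvPolynomial (Fin n) ℂ) :
    blowup I (fun i => Ideal.Quotient.mk I (F i)) =
      closure (projGraph (MvPolynomial.zeroLocus ℂ I) fun x i => MvPolynomial.eval x (F i)) := by
  rw [blowup]
  congr 1
  ext z
  exact ⟨fun ⟨hx, hv, hz⟩ => ⟨hx, hv, hz⟩, fun ⟨hx, hv, hz⟩ => ⟨hx, hv, hz⟩⟩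

/-- If the classes of `F` lie in the ideal generated by the classes of `G`, then on `V(I)` the
values of `F` are obtained from those of `G` by a polynomial matrix. -/
theorem exists_matrix_of_mem_span {n m k : ℕ} {I : Ideal (MvPolynomial (Fin n) ℂ)}
    {F : Fin k → MvPolynomial (Fin n) ℂ} {G : Fin m → MvPolynomial (Fin n) ℂ}
    (h : ∀ i, Ideal.Quotient.mk I (F i) ∈
      Ideal.span (Set.range fun j => Ideal.Quotient.mk I (G j))) :
    ∃ M : Matrix (Fin k) (Fin m) (MvPolynomial (Fin n) ℂ), ∀ x ∈ MvPolynomial.zeroLocus ℂ I,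
      ∀ i, MvPolynomial.eval x (F i) =
        ∑ j, MvPolynomial.eval x (M i j) * MvPolynomial.eval x (G j) := by
  choose c hc using fun i => Ideal.mem_span_range_iff_exists_fun.1 (h i)
  choose M hM using fun i j => Ideal.Quotient.mk_surjective (c i j)
  refine ⟨M, fun x hx i => ?_⟩
  have := congrArg (evalAt I ⟨x, hx⟩) (hc i)
  simp only [← hM, map_sum, map_mul, evalAt_mk] at this
  exact this.symm

theorem isomorphicOver_nashModification_blowup {n m : ℕ} {b : Fin n → ℕ} (hb : ∀ i, 0 < b i)
    (hsing : singularLocus (toricCurve b) = {0})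
    (f : Fin m → MvPolynomial (Fin n) ℂ ⧸ toricIdeal (curveVectors fun i => (b i : ℤ)))
    (hf : Ideal.span (Set.range f) =
      Ideal.span (Set.range (coord (curveVectors fun i => (b i : ℤ))))) :
    IsomorphicOver (nashModification (toricCurve b)) (blowup _ f) := by
  choose F hF using fun i => Ideal.Quotient.mk_surjective (f i)
  obtain rfl : (fun i => Ideal.Quotient.mk _ (F i)) = f := funext hF
  obtain ⟨A, hA⟩ := exists_matrix_of_mem_span (G := MvPolynomial.X)
    (fun i => (hf.le (Ideal.subset_span ⟨i, rfl⟩) : Ideal.Quotient.mk _ (F i) ∈ _))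
  obtain ⟨B, hB⟩ := exists_matrix_of_mem_span (F := MvPolynomial.X) (G := F)
    (I := toricIdeal (curveVectors fun i => (b i : ℤ)))
    (fun i => hf.ge (Ideal.subset_span ⟨i, rfl⟩))
  have hbne : ∀ i, (b i : ℂ) ≠ 0 := fun i => Nat.cast_ne_zero.2 (hb i).ne'
  rw [blowup_mk_eq, nashModification, gaussGraph_toricCurve hb hsing]
  refine isomorphicOver_closure_projGraph
    -- `A` and `B` relate the generators to the coordinates `xⱼ`; the factors `bⱼ⁻¹` and `bᵢ` adapt
    -- them to the Gauss vector `(bⱼ xⱼ)`.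
    (Matrix.of fun i j => A i j * MvPolynomial.C (b j : ℂ)⁻¹)
    (Matrix.of fun i j => MvPolynomial.C (b i : ℂ) * B i j) (fun x hx => ?_) (fun x hx => ?_)
  · funext i
    rw [hA x hx i]
    simp only [matrixAt, Matrix.mulVec, dotProduct, Matrix.map_apply, Matrix.of_apply, map_mul,
      MvPolynomial.eval_C, MvPolynomial.eval_X]
    refine Finset.sum_congr rfl fun j _ => ?_
    rw [mul_assoc, inv_mul_cancel_left₀ (hbne j)]
  · funext i
    have := hB x hx i
    rw [MvPolynomial.eval_X] at this
    rw [this, Finset.mul_sum]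
    simp only [matrixAt, Matrix.mulVec, dotProduct, Matrix.map_apply, Matrix.of_apply, map_mul,
      MvPolynomial.eval_C, mul_assoc]

end ToricNash

end

theorem mainTheorem8 (n : ℕ) (a : Fin n → ℤ) (hpos : ∀ i, 0 < a i) (hmono : StrictMono a)
    (hgcd : Finset.univ.gcd a = 1)
    (hsing : (ToricNash.singularLocus
      (ToricNash.toricVariety (ToricNash.curveVectors a))).Nonempty) :
    ToricNash.logJacobianIdeal (ToricNash.curveVectors a) =
        Ideal.span (Set.range (ToricNash.coord (ToricNash.curveVectors a))) ∧
      (∀ (m : ℕ) (f : Fin m →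
            MvPolynomial (Fin n) ℂ ⧸ ToricNash.toricIdeal (ToricNash.curveVectors a)),
          Ideal.span (Set.range f) = ToricNash.logJacobianIdeal (ToricNash.curveVectors a) →
          ToricNash.IsomorphicOver
            (ToricNash.nashModification (ToricNash.toricVariety (ToricNash.curveVectors a)))
            (ToricNash.blowup (ToricNash.toricIdeal (ToricNash.curveVectors a)) f)) ∧
      ToricNash.idealLocus (ToricNash.logJacobianIdeal (ToricNash.curveVectors a)) = {0} ∧
      ToricNash.singularLocus (ToricNash.toricVariety (ToricNash.curveVectors a)) =
        ToricNash.idealLocus (ToricNash.logJacobianIdeal (ToricNash.curveVectors a)) := by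
  obtain ⟨b, rfl⟩ : ∃ b : Fin n → ℕ, a = fun i => (b i : ℤ) :=
    ⟨fun i => (a i).toNat, funext fun i => (Int.toNat_of_nonneg (hpos i).le).symm⟩
  have hb : ∀ i, 0 < b i := fun i => Int.natCast_pos.1 (hpos i)
  have hsing0 : ToricNash.singularLocus (ToricNash.toricCurve b) = {0} :=
    (Set.subset_singleton_iff_eq.1
      (ToricNash.singularLocus_toricCurve_subset hb hgcd)).resolve_left hsing.ne_empty
  rw [ToricNash.logJacobianIdeal_curveVectors hpos, ToricNash.idealLocus_span_coord hb]
  exact ⟨rfl, fun m f hf => ToricNash.isomorphicOver_nashModification_blowup hb hsing0 f hf,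
    rfl, hsing0⟩
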